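/- Let $\mathbb{D}=\{z=x+iy\in\mathbb{C}:|z|<1\}$, and write $\partial/\partial z=\tfrac12(\partial_x-i\partial_y)$, $\partial/\partial\bar z=\tfrac12(\partial_x+i\partial_y)$, $\Delta=\partial_x^2+\partial_y^2$. For integers $p,q\ge 1$ the scattering polynomial $\varphi^{(p,q)}:\mathbb{C}\to\mathbb{C}$ is defined by $$\varphi^{(p,q)}(z)=\frac{(-1)^p}{q\,(p+q-1)!}\,(1-z\bar z)\,\frac{\partial^{p+q}}{\partial z^p\,\partial\bar z^q}(1-z\bar z)^{p+q-1}.$$ Let $P^{(a,b)}_n(u)=\sum_{s=0}^n\binom{n+a}{n-s}\binom{n+b}{s}\left(\frac{u-1}{2}\right)^s\left(\frac{u+1}{2}\right)^{n-s}$ denote the Jacobi polynomials ($a,b,n$ nonnegative integers). Then the following hold. 1. Each $\varphi^{(p,q)}$ is a polynomial in $x$ and $y$ with complex coefficients. 2. The family $\{\varphi^{(p,q)}\}_{p,q\ge1}$ is an orthogonal basis of the Hilbert space $L^2\bigl(\mathbb{D},\frac{dx\,dy}{1-x^2-y^2}\bigr)$ of complex-valued functions: every $\varphi^{(p,q)}$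 belongs to this space and is nonzero in it, $\varphi^{(p,q)}$ and $\varphi^{(p',q')}$ are orthogonal whenever $(p,q)\ne(p',q')$, and the linear span of the family is dense. 3. Every even moment of the measure is infinite: $\int_{\mathbb{D}}x^{2m}y^{2n}\frac{dx\,dy}{1-x^2-y^2}=\infty$ for all integers $m,n\ge0$. 4. For all integers $p,q\ge1$ and all $z\in\mathbb{C}$, $-\frac{1-|z|^2}{4}\,\Delta\varphi^{(p,q)}(z)=pq\,\varphi^{(p,q)}(z)$. 5. For all integers $p,q\ge1$ and all real $r,\theta$, $$\varphi^{(p,q)}(re^{i\theta})=\frac{(-1)^{q+1}\max\{p,q\}}{q}\,(1-r^2)\,r^{|p-q|}\,P^{(1,|p-q|)}_{\min\{p,q\}-1}(2r^2-1)\,e^{i(q-p)\theta}.$$ -/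

import Mathlib

/-- The Wirtinger derivative `∂/∂z = (∂/∂x - i ∂/∂y) / 2`. -/
noncomputable def wirtingerZ (f : ℂ → ℂ) (z : ℂ) : ℂ :=
  (fderiv ℝ f z 1 - Complex.I * fderiv ℝ f z Complex.I) / 2

/-- The Wirtinger derivative `∂/∂z̄ = (∂/∂x + i ∂/∂y) / 2`. -/
noncomputable def wirtingerZBar (f : ℂ → ℂ) (z : ℂ) : ℂ :=
  (fderiv ℝ f z 1 + Complex.I * fderiv ℝ f z Complex.I) / 2

/-- The scattering polynomial `φ^{(p,q)}`, as a function on `ℂ`, given by its Rodrigues type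
formula (of interest for `p, q ≥ 1`). -/
noncomputable def scatteringPoly (p q : ℕ) (z : ℂ) : ℂ :=
  (-1) ^ p / ((q : ℂ) * ((p + q - 1).factorial : ℂ)) * (1 - z * star z) *
    (wirtingerZ^[p] (wirtingerZBar^[q] fun w : ℂ => (1 - w * star w) ^ (p + q - 1))) z

/-- The measure `dx dy / (1 - x² - y²)` on the open unit disk, as a measure on `ℂ` that vanishes
off the disk. -/
noncomputable def diskMeasure : MeasureTheory.Measure ℂ :=
  (MeasureTheory.volume.restrict (Metric.ball (0 : ℂ) 1)).withDensity
    fun z => ENNReal.ofReal (1 / (1 - z.re ^ 2 - z.im ^ 2))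

/-- The Jacobi polynomial `P_n^{(a,b)}` for nonnegative integers `a, b`, in the standard
normalization `P_n^{(a,b)}(1) = (n + a).choose n`. -/
noncomputable def jacobiP (a b n : ℕ) (x : ℝ) : ℝ :=
  ∑ s ∈ Finset.range (n + 1), ((n + a).choose (n - s) : ℝ) * ((n + b).choose s : ℝ) *
    ((x - 1) / 2) ^ s * ((x + 1) / 2) ^ (n - s)

/-- An orthogonal basis of a Hilbert space: nonzero, pairwise orthogonal vectors whose linear span
is dense. -/
structure IsOrthogonalBasis {ι H : Type*} [NormedAddCommGroup H] [InnerProductSpace ℂ H]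
    (v : ι → H) : Prop where
  ne_zero : ∀ i, v i ≠ 0
  orthogonal : ∀ i j, i ≠ j → inner ℂ (v i) (v j) = 0
  dense_span : (Submodule.span ℂ (Set.range v)).topologicalClosure = ⊤

/-! Differentiating out the Rodrigues formula gives `φ^{(p,q)} = (1 - z z̄) F^{(p,q)}` with an
explicit cofactor `F^{(p,q)} = ∑_m c_m z^m z̄^(p+m-q)`. The differential equation is then a two-term
recurrence for `c_m`, and the Jacobi form follows from the Chu–Vandermonde identity.

In an inner product of two scattering polynomials one factor `1 - z z̄` cancels the weight. The
angular integral kills all pairs with `p - q ≠ p' - q'`; on the remaining ones, say with `q < q'`,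
the moments `∫ (1 - |z|²) |z|^(2k) = π / ((k + 1) (k + 2))` turn the integral into a finite
difference of order `q' - 1` of a polynomial of smaller degree, which vanishes.

For density, `F^{(j+1,i+1)}` equals a nonzero multiple of `z^i z̄^j` plus terms of lower degree in
`z`, so the cofactors span all polynomials in `z` and `z̄`. By Stone–Weierstrass, a function of the
weighted `L²` space orthogonal to every `φ^{(p,q)}` annihilates all continuous functions on the
closed disk and hence vanishes. The even moments diverge because `1 / (1 - r²)` is not integrable
at `r = 1`. -/

open MeasureTheory Filter Topology

section Wirtinger

variable {ι : Type*} (s : Finset ι) (c : ι → ℂ) (a b : ι → ℕ)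

theorem wirtingerZ_eq_of_hasFDerivAt {f : ℂ → ℂ} {u v z : ℂ} (h : HasFDerivAt f
    (u • ContinuousLinearMap.id ℝ ℂ + v • Complex.conjCLE.toContinuousLinearMap) z) :
    wirtingerZ f z = u := by
  simp only [wirtingerZ, h.fderiv, add_apply, smul_apply, ContinuousLinearMap.id_apply,
    ContinuousLinearEquiv.coe_coe, Complex.conjCLE_apply, map_one, Complex.conj_I, smul_eq_mul]
  linear_combination (v - u) / 2 * Complex.I_sq

theorem wirtingerZBar_eq_of_hasFDerivAt {f : ℂ → ℂ} {u v z : ℂ} (h : HasFDerivAt f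
    (u • ContinuousLinearMap.id ℝ ℂ + v • Complex.conjCLE.toContinuousLinearMap) z) :
    wirtingerZBar f z = v := by
  simp only [wirtingerZBar, h.fderiv, add_apply, smul_apply, ContinuousLinearMap.id_apply,
    ContinuousLinearEquiv.coe_coe, Complex.conjCLE_apply, map_one, Complex.conj_I, smul_eq_mul]
  linear_combination (u - v) / 2 * Complex.I_sq

theorem hasFDerivAt_pow_mul_star_pow (a b : ℕ) (z : ℂ) :
    HasFDerivAt (𝕜 := ℝ) (fun w : ℂ => w ^ a * star w ^ b)
      ((a * (z ^ (a - 1) * star z ^ b)) • ContinuousLinearMap.id ℝ ℂ +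
        (b * (z ^ a * star z ^ (b - 1))) • Complex.conjCLE.toContinuousLinearMap) z := by
  have h1 : HasFDerivAt (𝕜 := ℝ) (fun w : ℂ => w ^ a) _ z := (hasFDerivAt_id z).pow a
  have h2 : HasFDerivAt (𝕜 := ℝ) (fun w : ℂ => star w ^ b) _ z :=
    (Complex.conjCLE.toContinuousLinearMap.hasFDerivAt (x := z)).pow b
  refine (h1.mul h2).congr_fderiv (ContinuousLinearMap.ext fun v => ?_)
  simp only [ContinuousLinearEquiv.coe_coe, ContinuousAlgEquiv.coeCLE_apply,
    Complex.conjCAE_apply, nsmul_eq_mul, RCLike.star_def, id_eq, add_apply, smul_apply, smul_eq_mul,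
    ContinuousLinearMap.id_apply]
  ring

theorem hasFDerivAt_sum_pow_mul_star_pow (z : ℂ) :
    HasFDerivAt (𝕜 := ℝ) (fun w : ℂ => ∑ k ∈ s, c k * (w ^ a k * star w ^ b k))
      ((∑ k ∈ s, c k * a k * (z ^ (a k - 1) * star z ^ b k)) • ContinuousLinearMap.id ℝ ℂ +
        (∑ k ∈ s, c k * b k * (z ^ a k * star z ^ (b k - 1))) •
          Complex.conjCLE.toContinuousLinearMap) z := by
  refine (HasFDerivAt.fun_sum fun k _ =>
    (hasFDerivAt_pow_mul_star_pow (a k) (b k) z).const_mul (c k)).congr_fderiv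
      (ContinuousLinearMap.ext fun v => ?_)
  simp [Finset.sum_mul, Finset.sum_add_distrib, mul_assoc]

theorem contDiff_sum_pow_mul_star_pow {n : WithTop ℕ∞} :
    ContDiff ℝ n fun w : ℂ => ∑ k ∈ s, c k * (w ^ a k * star w ^ b k) :=
  ContDiff.sum fun _ _ =>
    contDiff_const.mul ((contDiff_id.pow _).mul (Complex.conjCLE.contDiff.pow _))

theorem wirtingerZ_sum :
    wirtingerZ (fun w : ℂ => ∑ k ∈ s, c k * (w ^ a k * star w ^ b k)) =
      fun w => ∑ k ∈ s, c k * a k * (w ^ (a k - 1) * star w ^ b k) :=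
  funext fun z => wirtingerZ_eq_of_hasFDerivAt (hasFDerivAt_sum_pow_mul_star_pow s c a b z)

theorem wirtingerZBar_sum :
    wirtingerZBar (fun w : ℂ => ∑ k ∈ s, c k * (w ^ a k * star w ^ b k)) =
      fun w => ∑ k ∈ s, c k * b k * (w ^ a k * star w ^ (b k - 1)) :=
  funext fun z => wirtingerZBar_eq_of_hasFDerivAt (hasFDerivAt_sum_pow_mul_star_pow s c a b z)

theorem iterate_wirtingerZ_sum (p : ℕ) :
    wirtingerZ^[p] (fun w : ℂ => ∑ k ∈ s, c k * (w ^ a k * star w ^ b k)) =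
      fun w => ∑ k ∈ s, c k * (a k).descFactorial p * (w ^ (a k - p) * star w ^ b k) := by
  induction p with
  | zero => simp
  | succ p ih =>
    rw [Function.iterate_succ_apply', ih, wirtingerZ_sum]
    simp only [Nat.descFactorial_succ, Nat.sub_sub, Nat.cast_mul, mul_assoc, mul_left_comm]

theorem iterate_wirtingerZBar_sum (q : ℕ) :
    wirtingerZBar^[q] (fun w : ℂ => ∑ k ∈ s, c k * (w ^ a k * star w ^ b k)) =
      fun w => ∑ k ∈ s, c k * (b k).descFactorial q * (w ^ a k * star w ^ (b k - q)) := by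
  induction q with
  | zero => simp
  | succ q ih =>
    rw [Function.iterate_succ_apply', ih, wirtingerZBar_sum]
    simp only [Nat.descFactorial_succ, Nat.sub_sub, Nat.cast_mul, mul_assoc, mul_left_comm]

theorem laplacian_eq_four_mul_wirtinger {f : ℂ → ℂ} {z : ℂ} (hf : ContDiffAt ℝ 2 f z) :
    Laplacian.laplacian f z = 4 * wirtingerZ (wirtingerZBar f) z := by
  have hd : DifferentiableAt ℝ (fderiv ℝ f) z :=
    (hf.fderiv_right (m := 1) (by norm_num)).differentiableAt (by norm_num)
  have happ (v : ℂ) : HasFDerivAt (fun w => fderiv ℝ f w v)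
      ((fderiv ℝ (fderiv ℝ f) z).flip v) z := by
    simpa using hd.hasFDerivAt.clm_apply (hasFDerivAt_const v z)
  have hbar : HasFDerivAt (wirtingerZBar f) _ z :=
    ((happ 1).add ((happ Complex.I).const_mul Complex.I)).mul_const (2⁻¹ : ℂ)
  have hsymm : fderiv ℝ (fderiv ℝ f) z 1 Complex.I = fderiv ℝ (fderiv ℝ f) z Complex.I 1 :=
    hf.isSymmSndFDerivAt (by simp) 1 Complex.I
  rw [InnerProductSpace.laplacian_eq_iteratedFDeriv_complexPlane, wirtingerZ, hbar.fderiv]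
  simp only [iteratedFDeriv_two_apply, Matrix.cons_val_zero, Matrix.cons_val_one,
    Matrix.cons_val_fin_one, smul_add, add_apply, smul_apply, ContinuousLinearMap.flip_apply,
    smul_eq_mul, hsymm]
  linear_combination (fderiv ℝ (fderiv ℝ f) z Complex.I Complex.I) * Complex.I_sq

theorem laplacian_sum_pow_mul_star_pow (z : ℂ) :
    Laplacian.laplacian (fun w : ℂ => ∑ k ∈ s, c k * (w ^ a k * star w ^ b k)) z =
      4 * ∑ k ∈ s, c k * (a k * b k) * (z ^ (a k - 1) * star z ^ (b k - 1)) := by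
  rw [laplacian_eq_four_mul_wirtinger (contDiff_sum_pow_mul_star_pow s c a b).contDiffAt,
    wirtingerZBar_sum, wirtingerZ_sum]
  simp only [mul_assoc, mul_left_comm]

theorem laplacian_one_sub_mul_sum_pow_mul_star_pow (z : ℂ) :
    Laplacian.laplacian
        (fun w : ℂ => (1 - w * star w) * ∑ k ∈ s, c k * (w ^ a k * star w ^ b k)) z =
      4 * ∑ k ∈ s, c k * (a k * b k * (z ^ (a k - 1) * star z ^ (b k - 1)) -
        (a k + 1) * (b k + 1) * (z ^ a k * star z ^ b k)) := by
  have hsub : (fun w : ℂ => (1 - w * star w) * ∑ k ∈ s, c k * (w ^ a k * star w ^ b k)) =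
      (fun w => ∑ k ∈ s, c k * (w ^ a k * star w ^ b k)) -
        fun w => ∑ k ∈ s, c k * (w ^ (a k + 1) * star w ^ (b k + 1)) := by
    funext w
    rw [Pi.sub_apply, sub_mul, one_mul, Finset.mul_sum]
    congr 1
    exact Finset.sum_congr rfl fun k _ => by ring
  rw [hsub, (contDiff_sum_pow_mul_star_pow s c a b).contDiffAt.laplacian_sub
      (contDiff_sum_pow_mul_star_pow s c _ _).contDiffAt, laplacian_sum_pow_mul_star_pow,
    laplacian_sum_pow_mul_star_pow s c (fun k => a k + 1) (fun k => b k + 1), ← mul_sub,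
    ← Finset.sum_sub_distrib]
  simp only [Nat.add_sub_cancel, Nat.cast_add_one, mul_sub, mul_assoc]

end Wirtinger

/-- The coefficient of `z ^ m * z̄ ^ (p + m - q)` in `φ^{(p,q)} / (1 - z z̄)`. It vanishes for
`p + m < q`, where the exponent of `z̄` is a truncated difference. -/
def scatteringCoeff (p q m : ℕ) : ℤ :=
  (-1) ^ m * (q - 1).choose m * (p + m).choose q

/-- The cofactor `φ^{(p,q)} / (1 - z z̄)` in expanded form. It is evaluated at an element of an
arbitrary ring with an involution, so that it can also be taken in an algebra of functions. -/
def scatteringCofactor {A : Type*} [Ring A] [Star A] (p q : ℕ) (x : A) : A :=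
  ∑ m ∈ Finset.range q, (scatteringCoeff p q m : A) * (x ^ m * star x ^ (p + m - q))

theorem scatteringCoeff_eq_zero_of_lt {p q m : ℕ} (h : p + m < q) : scatteringCoeff p q m = 0 := by
  simp [scatteringCoeff, Nat.choose_eq_zero_of_lt h]

theorem scatteringCoeff_self {p q : ℕ} (hq : 1 ≤ q) : scatteringCoeff p q q = 0 := by
  simp [scatteringCoeff, Nat.choose_eq_zero_of_lt (Nat.sub_lt hq one_pos)]

theorem continuous_scatteringCofactor (p q : ℕ) :
    Continuous (scatteringCofactor p q : ℂ → ℂ) := by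
  unfold scatteringCofactor
  fun_prop

theorem choose_add_mul_descFactorial_mul_descFactorial (p n m : ℕ) :
    (p + n).choose (p + m) * (p + m).descFactorial (n + 1) * (p + m).descFactorial p =
      (n + 1) * (p + n).factorial * (n.choose m * (p + m).choose (n + 1)) := by
  have hchoose : (p + n).choose (p + m) * (p + m).choose p = (p + n).choose p * n.choose m := by
    simpa using Nat.choose_mul (n := p + n) (Nat.le_add_right p m)
  have hfact : n.factorial * (p.factorial * (p + n).choose p) = (p + n).factorial := by
    simpa [Nat.descFactorial_eq_factorial_mul_choose] using
      Nat.factorial_mul_descFactorial (Nat.le_add_right p n)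
  rw [Nat.descFactorial_eq_factorial_mul_choose, Nat.descFactorial_eq_factorial_mul_choose,
    Nat.factorial_succ, ← hfact]
  linear_combination (n + 1) * n.factorial * p.factorial * (p + m).choose (n + 1) * hchoose

theorem mul_star_eq_norm_sq (z : ℂ) : z * star z = (‖z‖ : ℂ) ^ 2 :=
  Complex.mul_conj' z

theorem one_sub_mul_star_pow (n : ℕ) (w : ℂ) :
    (1 - w * star w) ^ n =
      ∑ k ∈ Finset.range (n + 1), ((-1) ^ k * n.choose k : ℂ) * (w ^ k * star w ^ k) := by
  rw [sub_eq_neg_add, add_pow]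
  refine Finset.sum_congr rfl fun k _ => ?_
  rw [neg_pow, mul_pow, one_pow]
  ring

theorem neg_one_pow_div_mul_eq_scatteringCoeff (p n m : ℕ) :
    (-1) ^ p / ((n + 1) * (p + n).factorial) * ((-1) ^ (p + m) * (p + n).choose (p + m) *
      (p + m).descFactorial (n + 1) * (p + m).descFactorial p) =
      (scatteringCoeff p (n + 1) m : ℂ) := by
  have hcoeff : ((p + n).choose (p + m) * (p + m).descFactorial (n + 1) *
      (p + m).descFactorial p : ℂ) =
      (n + 1) * (p + n).factorial * (n.choose m * (p + m).choose (n + 1)) :=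
    mod_cast choose_add_mul_descFactorial_mul_descFactorial p n m
  have hsign : (-1 : ℂ) ^ p * (-1) ^ (p + m) = (-1) ^ m := by
    rw [pow_add, ← mul_assoc, ← mul_pow, neg_one_mul, neg_neg, one_pow, one_mul]
  have hn : (n + 1 : ℂ) ≠ 0 := n.cast_add_one_ne_zero
  have hfact : ((p + n).factorial : ℂ) ≠ 0 := mod_cast (p + n).factorial_ne_zero
  rw [scatteringCoeff, Nat.add_sub_cancel]
  push_cast
  rw [div_mul_eq_mul_div, div_eq_iff (mul_ne_zero hn hfact), ← hsign]
  linear_combination (-1) ^ p * (-1) ^ (p + m) * hcoeff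

theorem scatteringPoly_eq_mul_cofactor (p : ℕ) {q : ℕ} (hq : 1 ≤ q) (z : ℂ) :
    scatteringPoly p q z = (1 - z * star z) * scatteringCofactor p q z := by
  obtain ⟨n, rfl⟩ := Nat.exists_eq_add_of_le' hq
  have hN : p + (n + 1) - 1 = p + n := by omega
  rw [scatteringPoly, hN, funext (one_sub_mul_star_pow (p + n)), iterate_wirtingerZBar_sum,
    iterate_wirtingerZ_sum, mul_comm _ (1 - z * star z), mul_assoc, add_assoc p n 1]
  beta_reduce
  rw [Finset.sum_range_add, Finset.sum_eq_zero, zero_add, Finset.mul_sum, scatteringCofactor]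
  · congr 1
    refine Finset.sum_congr rfl fun m _ => ?_
    rw [← neg_one_pow_div_mul_eq_scatteringCoeff, Nat.add_sub_cancel_left]
    push_cast
    ring
  · intro k hk
    simp [Nat.descFactorial_of_lt (Finset.mem_range.1 hk)]

theorem exists_mvPolynomial_eq_scatteringPoly (p : ℕ) {q : ℕ} (hq : 1 ≤ q) :
    ∃ P : MvPolynomial (Fin 2) ℂ, ∀ z : ℂ,
      scatteringPoly p q z = MvPolynomial.eval ![(z.re : ℂ), (z.im : ℂ)] P := by
  let Z : MvPolynomial (Fin 2) ℂ := .X 0 + .C Complex.I * .X 1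
  let W : MvPolynomial (Fin 2) ℂ := .X 0 - .C Complex.I * .X 1
  refine ⟨(1 - Z * W) * ∑ m ∈ Finset.range q, (scatteringCoeff p q m : MvPolynomial (Fin 2) ℂ) *
    (Z ^ m * W ^ (p + m - q)), fun z => ?_⟩
  have hZ : MvPolynomial.eval ![(z.re : ℂ), (z.im : ℂ)] Z = z := by
    apply Complex.ext <;> simp [Z]
  have hW : MvPolynomial.eval ![(z.re : ℂ), (z.im : ℂ)] W = star z := by
    apply Complex.ext <;> simp [W]
  simp only [scatteringPoly_eq_mul_cofactor p hq, scatteringCofactor, map_mul, map_sub, map_one,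
    map_sum, map_pow, map_intCast, hZ, hW]

section Eigenfunction

variable {p q m : ℕ}

theorem scatteringCoeff_succ_mul (hm : m < q) (hpm : q ≤ p + m) :
    scatteringCoeff p q (m + 1) * ((m + 1) * (p + m + 1 - q)) =
      -((q - 1 - m) * (p + m + 1)) * scatteringCoeff p q m := by
  have hleft : ((q - 1).choose (m + 1) * (m + 1) : ℤ) = (q - 1).choose m * (q - 1 - m) := by
    have h := congrArg (Nat.cast : ℕ → ℤ) (Nat.choose_succ_right_eq (q - 1) m)
    push_cast [Nat.cast_sub (by omega : m ≤ q - 1), Nat.cast_sub (by omega : 1 ≤ q)] at h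
    exact h
  have hright : ((p + m).choose q * (p + m + 1) : ℤ) =
      (p + (m + 1)).choose q * (p + m + 1 - q) := by
    have h := congrArg (Nat.cast : ℕ → ℤ) (Nat.choose_mul_succ_eq (p + m) q)
    push_cast [Nat.cast_sub (by omega : q ≤ p + m + 1)] at h
    exact h
  simp only [scatteringCoeff]
  linear_combination -(-1) ^ m * (p + (m + 1)).choose q * (p + m + 1 - q) * hleft +
    (-1) ^ m * (q - 1).choose m * (q - 1 - m) * hright

theorem scatteringCoeff_recurrence (hm : m < q) :
    scatteringCoeff p q (m + 1) * ((m + 1) * (p + m + 1 - q : ℕ)) -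
      scatteringCoeff p q m * ((m + 1) * ((p + m - q : ℕ) + 1)) =
      -(p * q * scatteringCoeff p q m) := by
  rcases lt_or_ge (p + m) q with h | h
  · simp [scatteringCoeff_eq_zero_of_lt h, Nat.sub_eq_zero_of_le (Nat.succ_le_of_lt h)]
  · push_cast [Nat.cast_sub h, Nat.cast_sub (Nat.le_succ_of_le h)]
    linear_combination scatteringCoeff_succ_mul hm h

theorem sum_scatteringCoeff_mul_shift {q : ℕ} (p : ℕ) (hq : 1 ≤ q) (z : ℂ) :
    ∑ m ∈ Finset.range q, (scatteringCoeff p q m : ℂ) *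
        (m * (p + m - q : ℕ) * (z ^ (m - 1) * star z ^ (p + m - q - 1))) =
      ∑ m ∈ Finset.range q, (scatteringCoeff p q (m + 1) : ℂ) *
        ((m + 1) * (p + m + 1 - q : ℕ) * (z ^ m * star z ^ (p + m - q))) := by
  have h := (Finset.sum_range_succ _ q).symm.trans (Finset.sum_range_succ' (fun m =>
    (scatteringCoeff p q m : ℂ) *
      (m * (p + m - q : ℕ) * (z ^ (m - 1) * star z ^ (p + m - q - 1)))) q)
  have hexp (m : ℕ) : p + m + 1 - q - 1 = p + m - q := by omega
  simpa [scatteringCoeff_self hq, ← add_assoc, hexp] using h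

theorem laplacian_scatteringPoly (p : ℕ) (hq : 1 ≤ q) (z : ℂ) :
    Laplacian.laplacian (scatteringPoly p q) z = -(4 * (p * q * scatteringCofactor p q z)) := by
  rw [funext (scatteringPoly_eq_mul_cofactor p hq)]
  simp only [scatteringCofactor]
  rw [laplacian_one_sub_mul_sum_pow_mul_star_pow, ← mul_neg]
  congr 1
  simp only [mul_sub, Finset.sum_sub_distrib]
  rw [sum_scatteringCoeff_mul_shift p hq, ← Finset.sum_sub_distrib, Finset.mul_sum,
    ← Finset.sum_neg_distrib]
  refine Finset.sum_congr rfl fun m hm => ?_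
  have h := congrArg (Int.cast : ℤ → ℂ)
    (scatteringCoeff_recurrence (p := p) (Finset.mem_range.1 hm))
  push_cast at h
  linear_combination (z ^ m * star z ^ (p + m - q)) * h

theorem neg_mul_laplacian_scatteringPoly (p : ℕ) (hq : 1 ≤ q) (z : ℂ) :
    -((1 - (‖z‖ : ℂ) ^ 2) / 4 * Laplacian.laplacian (scatteringPoly p q) z) =
      p * q * scatteringPoly p q z := by
  rw [laplacian_scatteringPoly p hq, scatteringPoly_eq_mul_cofactor p hq, mul_star_eq_norm_sq]
  ring

end Eigenfunction

section Jacobi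

theorem sum_choose_mul_choose_mul_choose (α β i l : ℕ) :
    ∑ s ∈ Finset.range (i + l + 1),
        (i + l + α).choose (i + l - s) * (i + l + β).choose s * s.choose i =
      (i + l + β).choose i * (i + l + α + β + l).choose l := by
  rw [add_assoc i l 1, Finset.sum_range_add, Finset.sum_eq_zero, zero_add,
    (by ring : i + l + α + β + l = l + β + (i + l + α)), Nat.add_choose_eq (l + β),
    Finset.Nat.sum_antidiagonal_eq_sum_range_succ
      (fun u v => (l + β).choose u * (i + l + α).choose v), Finset.mul_sum]
  · refine Finset.sum_congr rfl fun u _ => ?_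
    rw [mul_assoc, Nat.choose_mul (Nat.le_add_right i u), add_assoc i l β,
      Nat.add_sub_cancel_left, Nat.add_sub_cancel_left, Nat.add_sub_add_left]
    ring
  · intro s hs
    simp [Nat.choose_eq_zero_of_lt (Finset.mem_range.1 hs)]

theorem sub_one_pow_mul_pow_sub {n s : ℕ} (hs : s ≤ n) (t : ℝ) :
    (t - 1) ^ s * t ^ (n - s) =
      ∑ i ∈ Finset.range (n + 1), (-1) ^ i * s.choose i * t ^ (n - i) := by
  rw [sub_eq_neg_add, add_pow, Finset.sum_mul]
  refine (Finset.sum_congr rfl fun i hi => ?_).trans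
    (Finset.sum_subset (Finset.range_mono (Nat.succ_le_succ hs)) fun i _ hi => ?_)
  · have hi : i ≤ s := Finset.mem_range_succ_iff.1 hi
    rw [(by omega : n - i = (s - i) + (n - s)), pow_add]
    ring
  · rw [Nat.choose_eq_zero_of_lt (by simpa using hi), Nat.cast_zero, mul_zero, zero_mul]

theorem jacobiP_two_mul_sub_one (α β n : ℕ) (t : ℝ) :
    jacobiP α β n (2 * t - 1) = ∑ j ∈ Finset.range (n + 1),
      (-1) ^ (n - j) * ((n + β).choose (n - j) * (n + α + β + j).choose j) * t ^ j := by
  have hterm : ∀ s ∈ Finset.range (n + 1),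
      ((n + α).choose (n - s) * (n + β).choose s * ((2 * t - 1 - 1) / 2) ^ s *
        ((2 * t - 1 + 1) / 2) ^ (n - s) : ℝ) = ∑ i ∈ Finset.range (n + 1),
          (-1) ^ i * ((n + α).choose (n - s) * (n + β).choose s * s.choose i) * t ^ (n - i) := by
    intro s hs
    rw [(by ring : (2 * t - 1 - 1) / 2 = t - 1), (by ring : (2 * t - 1 + 1) / 2 = t),
      mul_assoc, sub_one_pow_mul_pow_sub (Finset.mem_range_succ_iff.1 hs), Finset.mul_sum]
    exact Finset.sum_congr rfl fun i _ => by ring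
  rw [jacobiP, Finset.sum_congr rfl hterm, Finset.sum_comm, ← Finset.sum_flip]
  refine Finset.sum_congr rfl fun j hj => ?_
  obtain ⟨i, rfl⟩ := Nat.exists_eq_add_of_le' (Finset.mem_range_succ_iff.1 hj)
  have hvandermonde := congrArg (Nat.cast : ℕ → ℝ) (sum_choose_mul_choose_mul_choose α β i j)
  push_cast at hvandermonde
  rw [Nat.add_sub_cancel, Nat.add_sub_cancel_left, ← Finset.sum_mul, ← Finset.mul_sum,
    hvandermonde]

theorem jacobiP_one (α β n : ℕ) : jacobiP α β n 1 = (n + α).choose n := by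
  rw [jacobiP, Finset.sum_range_succ', Finset.sum_eq_zero fun s _ => by simp]
  simp

theorem succ_mul_choose_mul_choose (N j m : ℕ) :
    (j + m + 1) * ((j + m).choose j * (N + 1 + j).choose (j + m + 1)) =
      (N + 1) * (N.choose m * (N + 1 + j).choose j) := by
  have h1 := Nat.choose_mul_succ_eq (j + m) j
  have h2 := Nat.choose_mul (n := N + 1 + j) (k := j + m + 1) (s := j) (by omega)
  have h3 := Nat.add_one_mul_choose_eq N m
  rw [(by omega : j + m + 1 - j = m + 1)] at h1 h2
  rw [Nat.add_sub_cancel] at h2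
  linear_combination (N + 1 + j).choose (j + m + 1) * h1 + (m + 1) * h2 -
    (N + 1 + j).choose j * h3

theorem scatteringCofactor_of_ge (n a : ℕ) (z : ℂ) :
    (n + 1) * scatteringCofactor (n + a + 1) (n + 1) z =
      (-1) ^ n * (n + a + 1) * jacobiP 1 a n (2 * ‖z‖ ^ 2 - 1) * star z ^ a := by
  rw [scatteringCofactor, jacobiP_two_mul_sub_one]
  push_cast
  rw [← mul_star_eq_norm_sq, Finset.mul_sum, Finset.mul_sum, Finset.sum_mul]
  refine Finset.sum_congr rfl fun j hj => ?_
  obtain ⟨m, rfl⟩ := Nat.exists_eq_add_of_le (Finset.mem_range_succ_iff.1 hj)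
  have hcoeff := congrArg (Nat.cast : ℕ → ℂ) (succ_mul_choose_mul_choose (j + m + a) j m)
  have hsign : (-1 : ℂ) ^ (j + m) * (-1) ^ m = (-1) ^ j := by
    rw [pow_add, mul_assoc, ← mul_pow, neg_one_mul, neg_neg, one_pow, mul_one]
  push_cast at hcoeff
  rw [scatteringCoeff, Nat.add_sub_cancel, Nat.add_sub_cancel_left,
    (by omega : j + m + a + 1 + j - (j + m + 1) = j + a),
    (by omega : j + m + 1 + a + j = j + m + a + 1 + j)]
  push_cast
  rw [← hsign]
  linear_combination (-1) ^ (j + m) * (-1) ^ m * z ^ j * star z ^ (j + a) * hcoeff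

theorem scatteringCofactor_of_le (n a : ℕ) (z : ℂ) :
    scatteringCofactor (n + 1) (n + a + 1) z =
      (-1) ^ (n + a) * jacobiP 1 a n (2 * ‖z‖ ^ 2 - 1) * z ^ a := by
  rw [scatteringCofactor, (by omega : n + a + 1 = a + (n + 1)), Finset.sum_range_add,
    Finset.sum_eq_zero, zero_add, jacobiP_two_mul_sub_one]
  · push_cast
    rw [← mul_star_eq_norm_sq, Finset.mul_sum, Finset.sum_mul]
    refine Finset.sum_congr rfl fun j hj => ?_
    obtain ⟨m, rfl⟩ := Nat.exists_eq_add_of_le (Finset.mem_range_succ_iff.1 hj)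
    have hchoose : (j + m + a).choose (a + j) = (j + m + a).choose m :=
      Nat.choose_symm_of_eq_add (by omega)
    have hchoose' : (j + m + 1 + a + j).choose (a + (j + m + 1)) = (j + m + 1 + a + j).choose j :=
      Nat.choose_symm_of_eq_add (by omega)
    have hsign : (-1 : ℂ) ^ (j + m + a) * (-1) ^ m = (-1) ^ (a + j) := by
      rw [(by omega : j + m + a = a + j + m), pow_add, mul_assoc, ← mul_pow, neg_one_mul, neg_neg,
        one_pow, mul_one]
    rw [scatteringCoeff, (by omega : a + (j + m + 1) - 1 = j + m + a), Nat.add_sub_cancel_left,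
      (by omega : j + m + 1 + (a + j) = j + m + 1 + a + j), hchoose, hchoose',
      (by omega : j + m + 1 + a + j - (a + (j + m + 1)) = j)]
    push_cast
    rw [← hsign]
    ring
  · intro m hm
    rw [scatteringCoeff_eq_zero_of_lt (by have := Finset.mem_range.1 hm; omega), Int.cast_zero,
      zero_mul]

theorem star_mul_exp_I_mul (r θ : ℝ) :
    star (r * Complex.exp (Complex.I * θ)) = r * Complex.exp (-(Complex.I * θ)) := by
  rw [← starRingEnd_apply, map_mul, Complex.conj_ofReal, ← Complex.exp_conj, map_mul,
    Complex.conj_I, Complex.conj_ofReal, neg_mul]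

theorem norm_mul_exp_I_mul_sq (r θ : ℝ) : ‖(r : ℂ) * Complex.exp (Complex.I * θ)‖ ^ 2 = r ^ 2 := by
  rw [norm_mul, mul_comm Complex.I, Complex.norm_exp_ofReal_mul_I, mul_one, Complex.norm_real,
    Real.norm_eq_abs, sq_abs]

theorem scatteringCofactor_polar {p q : ℕ} (hp : 1 ≤ p) (hq : 1 ≤ q) (r θ : ℝ) :
    scatteringCofactor p q (r * Complex.exp (Complex.I * θ)) =
      (-1) ^ (q + 1) * (max p q : ℕ) / (q : ℂ) *
        ((r ^ ((p : ℤ) - (q : ℤ)).natAbs *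
          jacobiP 1 ((p : ℤ) - (q : ℤ)).natAbs (min p q - 1) (2 * r ^ 2 - 1) : ℝ) : ℂ) *
        Complex.exp (Complex.I * ((q : ℂ) - (p : ℂ)) * θ) := by
  rcases le_total q p with h | h
  · obtain ⟨n, rfl⟩ := Nat.exists_eq_add_of_le' hq
    obtain ⟨a, rfl⟩ : ∃ a, p = n + a + 1 := ⟨p - (n + 1), by omega⟩
    have hn : (n + 1 : ℂ) ≠ 0 := n.cast_add_one_ne_zero
    rw [max_eq_left h, min_eq_right h,
      (by omega : (((n + a + 1 : ℕ) : ℤ) - ((n + 1 : ℕ) : ℤ)).natAbs = a), Nat.add_sub_cancel,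
      ← mul_right_inj' hn, scatteringCofactor_of_ge, norm_mul_exp_I_mul_sq, star_mul_exp_I_mul,
      mul_pow, ← Complex.exp_nat_mul]
    push_cast
    rw [(by ring : (a : ℂ) * -(Complex.I * θ) = Complex.I * (n + 1 - (n + a + 1)) * θ)]
    field_simp
    ring
  · obtain ⟨n, rfl⟩ := Nat.exists_eq_add_of_le' hp
    obtain ⟨a, rfl⟩ : ∃ a, q = n + a + 1 := ⟨q - (n + 1), by omega⟩
    have hq0 : (n + a + 1 : ℂ) ≠ 0 := by norm_cast
    rw [max_eq_right h, min_eq_left h,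
      (by omega : (((n + 1 : ℕ) : ℤ) - ((n + a + 1 : ℕ) : ℤ)).natAbs = a), Nat.add_sub_cancel,
      scatteringCofactor_of_le, norm_mul_exp_I_mul_sq, mul_pow, ← Complex.exp_nat_mul]
    push_cast
    rw [(by ring : (a : ℂ) * (Complex.I * θ) = Complex.I * (n + a + 1 - (n + 1)) * θ)]
    field_simp
    ring

theorem scatteringPoly_polar {p q : ℕ} (hp : 1 ≤ p) (hq : 1 ≤ q) (r θ : ℝ) :
    scatteringPoly p q ((r : ℂ) * Complex.exp (Complex.I * θ)) =
      (-1) ^ (q + 1) * (max p q : ℕ) / (q : ℂ) *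
        (((1 - r ^ 2) * r ^ ((p : ℤ) - (q : ℤ)).natAbs *
          jacobiP 1 ((p : ℤ) - (q : ℤ)).natAbs (min p q - 1) (2 * r ^ 2 - 1) : ℝ) : ℂ) *
        Complex.exp (Complex.I * ((q : ℂ) - (p : ℂ)) * θ) := by
  rw [scatteringPoly_eq_mul_cofactor p hq, scatteringCofactor_polar hp hq, mul_star_eq_norm_sq,
    ← Complex.ofReal_pow, norm_mul_exp_I_mul_sq]
  push_cast
  ring

theorem scatteringCofactor_one {p q : ℕ} (hp : 1 ≤ p) (hq : 1 ≤ q) :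
    scatteringCofactor p q (1 : ℂ) =
      (-1) ^ (q + 1) * (max p q : ℕ) / q * ((min p q - 1 : ℕ) + 1) := by
  simpa [jacobiP_one, (by norm_num : (2 - 1 : ℝ) = 1)] using scatteringCofactor_polar hp hq 1 0

theorem scatteringCofactor_one_ne_zero {p q : ℕ} (hp : 1 ≤ p) (hq : 1 ≤ q) :
    scatteringCofactor p q (1 : ℂ) ≠ 0 := by
  have hmax : ((max p q : ℕ) : ℂ) ≠ 0 := Nat.cast_ne_zero.2 (by omega)
  have hq' : (q : ℂ) ≠ 0 := Nat.cast_ne_zero.2 (by omega)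
  rw [scatteringCofactor_one hp hq]
  exact mul_ne_zero (div_ne_zero (mul_ne_zero (by simp) hmax) hq') (Nat.cast_add_one_ne_zero _)

end Jacobi

section DiskMeasure

theorem one_sub_re_sq_sub_im_sq (z : ℂ) : 1 - z.re ^ 2 - z.im ^ 2 = 1 - ‖z‖ ^ 2 := by
  rw [Complex.sq_norm, Complex.normSq_apply]
  ring

theorem one_sub_mul_star (z : ℂ) : 1 - z * star z = ((1 - ‖z‖ ^ 2 : ℝ) : ℂ) := by
  rw [mul_star_eq_norm_sq]
  push_cast
  rfl

theorem one_sub_norm_sq_pos {z : ℂ} (hz : z ∈ Metric.ball (0 : ℂ) 1) : 0 < 1 - ‖z‖ ^ 2 :=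
  sub_pos.2 (pow_lt_one₀ (norm_nonneg z) (mem_ball_zero_iff.1 hz) two_ne_zero)

theorem diskMeasure_eq_withDensity :
    diskMeasure = (volume.restrict (Metric.ball (0 : ℂ) 1)).withDensity
      fun z => ENNReal.ofReal (1 - ‖z‖ ^ 2)⁻¹ := by
  simp only [diskMeasure, one_sub_re_sq_sub_im_sq, one_div]

theorem lintegral_diskMeasure {f : ℂ → ENNReal} (hf : Measurable f) :
    ∫⁻ z, f z ∂diskMeasure =
      ∫⁻ z in Metric.ball (0 : ℂ) 1, ENNReal.ofReal (1 - ‖z‖ ^ 2)⁻¹ * f z := by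
  rw [diskMeasure_eq_withDensity, lintegral_withDensity_eq_lintegral_mul _ (by fun_prop) hf]
  rfl

theorem integral_diskMeasure (f : ℂ → ℂ) :
    ∫ z, f z ∂diskMeasure = ∫ z in Metric.ball (0 : ℂ) 1, (1 - z * star z)⁻¹ * f z := by
  rw [diskMeasure_eq_withDensity,
    integral_withDensity_eq_integral_toReal_smul (by fun_prop) (by simp)]
  refine setIntegral_congr_fun measurableSet_ball fun z hz => ?_
  rw [ENNReal.toReal_ofReal (inv_nonneg.2 (one_sub_norm_sq_pos hz).le), one_sub_mul_star,
    Complex.real_smul, Complex.ofReal_inv]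

theorem volume_restrict_ball_le_diskMeasure :
    volume.restrict (Metric.ball (0 : ℂ) 1) ≤ diskMeasure := by
  rw [diskMeasure_eq_withDensity]
  conv_lhs => rw [← withDensity_one (μ := volume.restrict (Metric.ball (0 : ℂ) 1))]
  refine withDensity_mono ?_
  filter_upwards [ae_restrict_mem measurableSet_ball] with z hz
  rw [Pi.one_apply, ENNReal.one_le_ofReal]
  exact one_le_inv_iff₀.2 ⟨one_sub_norm_sq_pos hz, sub_le_self _ (sq_nonneg _)⟩

theorem diskMeasure_absolutelyContinuous :
    diskMeasure ≪ volume.restrict (Metric.ball (0 : ℂ) 1) :=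
  withDensity_absolutelyContinuous _ _

theorem integrableOn_ball_of_continuous {E : Type*} [NormedAddCommGroup E] {f : ℂ → E}
    (hf : Continuous f) (R : ℝ) : IntegrableOn f (Metric.ball (0 : ℂ) R) :=
  (hf.continuousOn.integrableOn_compact (isCompact_closedBall 0 R)).mono_set
    Metric.ball_subset_closedBall

theorem memLp_one_sub_mul_star_mul {g : ℂ → ℂ} (hg : Continuous g) :
    MemLp (fun z => (1 - z * star z) * g z) 2 diskMeasure := by
  rw [memLp_two_iff_integrable_sq_norm (by fun_prop), diskMeasure_eq_withDensity,
    integrable_withDensity_iff (by fun_prop) (by simp)]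
  have hint : IntegrableOn (fun z : ℂ => (1 - ‖z‖ ^ 2) * ‖g z‖ ^ 2) (Metric.ball 0 1) :=
    integrableOn_ball_of_continuous (by fun_prop) 1
  refine hint.congr_fun (fun z hz => ?_) measurableSet_ball
  have hpos := one_sub_norm_sq_pos hz
  beta_reduce
  rw [ENNReal.toReal_ofReal (inv_nonneg.2 hpos.le), one_sub_mul_star, norm_mul, Complex.norm_real,
    Real.norm_of_nonneg hpos.le]
  field_simp

theorem inner_toLp_eq_setIntegral {f φ g : ℂ → ℂ} (hf : MemLp f 2 diskMeasure)
    (hφ : MemLp φ 2 diskMeasure) (hφg : ∀ z, φ z = (1 - z * star z) * g z) :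
    inner ℂ (hf.toLp f) (hφ.toLp φ) = ∫ z in Metric.ball (0 : ℂ) 1, star (f z) * g z := by
  have hinner : inner ℂ (hf.toLp f) (hφ.toLp φ) = ∫ z, star (f z) * φ z ∂diskMeasure := by
    rw [L2.inner_def]
    refine integral_congr_ae ?_
    filter_upwards [hf.coeFn_toLp, hφ.coeFn_toLp] with z h1 h2
    rw [h1, h2, RCLike.inner_apply, mul_comm, starRingEnd_apply]
  rw [hinner, integral_diskMeasure]
  refine setIntegral_congr_fun measurableSet_ball fun z hz => ?_
  have hne : 1 - z * star z ≠ 0 := by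
    rw [one_sub_mul_star]
    exact_mod_cast (one_sub_norm_sq_pos hz).ne'
  rw [hφg, mul_left_comm (star (f z)), inv_mul_cancel_left₀ hne]

end DiskMeasure

section Polar

theorem polarCoord_symm_eq_mul_exp (x : ℝ × ℝ) :
    Complex.polarCoord.symm x = x.1 * Complex.exp (Complex.I * x.2) := by
  rw [Complex.polarCoord_symm_apply, mul_comm Complex.I, Complex.exp_mul_I, Complex.ofReal_cos,
    Complex.ofReal_sin]

theorem measurable_polarCoord_symm : Measurable Complex.polarCoord.symm := by
  rw [funext polarCoord_symm_eq_mul_exp]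
  fun_prop

theorem polarCoord_target_inter_preimage_ball (R : ℝ) :
    polarCoord.target ∩ Complex.polarCoord.symm ⁻¹' Metric.ball 0 R =
      Set.Ioo 0 R ×ˢ Set.Ioo (-Real.pi) Real.pi := by
  ext x
  simp only [polarCoord_target, Set.mem_inter_iff, Set.mem_prod, Set.mem_Ioi, Set.mem_preimage,
    mem_ball_zero_iff, Complex.norm_polarCoord_symm, Set.mem_Ioo]
  constructor
  · rintro ⟨⟨h0, hθ⟩, hR⟩
    exact ⟨⟨h0, by rwa [abs_of_pos h0] at hR⟩, hθ⟩
  · rintro ⟨⟨h0, hR⟩, hθ⟩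
    exact ⟨⟨h0, hθ⟩, by rwa [abs_of_pos h0]⟩

theorem setIntegral_ball_eq_polar {E : Type*} [NormedAddCommGroup E] [NormedSpace ℝ E] (R : ℝ)
    (f : ℂ → E) :
    ∫ z in Metric.ball (0 : ℂ) R, f z =
      ∫ x in Set.Ioo 0 R ×ˢ Set.Ioo (-Real.pi) Real.pi,
        x.1 • f (Complex.polarCoord.symm x) := by
  rw [← integral_indicator measurableSet_ball, ← Complex.integral_comp_polarCoord_symm,
    ← polarCoord_target_inter_preimage_ball,
    ← setIntegral_indicator (measurable_polarCoord_symm measurableSet_ball)]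
  congr 1 with x
  by_cases hx : Complex.polarCoord.symm x ∈ Metric.ball 0 R <;>
    simp [hx, -Complex.polarCoord_symm_apply]

theorem setLIntegral_ball_eq_polar (R : ℝ) (f : ℂ → ENNReal) :
    ∫⁻ z in Metric.ball (0 : ℂ) R, f z =
      ∫⁻ x in Set.Ioo 0 R ×ˢ Set.Ioo (-Real.pi) Real.pi,
        ENNReal.ofReal x.1 * f (Complex.polarCoord.symm x) := by
  rw [← lintegral_indicator measurableSet_ball, ← Complex.lintegral_comp_polarCoord_symm,
    ← polarCoord_target_inter_preimage_ball, Set.inter_comm,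
    ← setLIntegral_indicator (measurable_polarCoord_symm measurableSet_ball)]
  congr 1 with x
  by_cases hx : Complex.polarCoord.symm x ∈ Metric.ball 0 R <;>
    simp [hx, -Complex.polarCoord_symm_apply]

theorem integral_exp_I_mul_int_mul (n : ℤ) :
    ∫ θ in Set.Ioo (-Real.pi) Real.pi, Complex.exp (Complex.I * n * θ) =
      if n = 0 then 2 * (Real.pi : ℂ) else 0 := by
  rw [← integral_Ioc_eq_integral_Ioo, ← intervalIntegral.integral_of_le (by linarith [Real.pi_pos])]
  split_ifs with hn
  · simp [hn, two_mul]
  · have hc : Complex.I * n ≠ 0 := by simp [hn]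
    rw [integral_exp_mul_complex hc, div_eq_zero_iff, sub_eq_zero]
    left
    rw [Complex.exp_eq_exp_iff_exists_int]
    exact ⟨n, by push_cast; ring⟩

theorem mul_exp_pow_mul_star_pow (r θ : ℝ) (i j : ℕ) :
    ((r : ℂ) * Complex.exp (Complex.I * θ)) ^ i * star ((r : ℂ) * Complex.exp (Complex.I * θ)) ^ j =
      r ^ (i + j) * Complex.exp (Complex.I * ((i - j : ℤ) : ℂ) * θ) := by
  rw [star_mul_exp_I_mul, mul_pow, mul_pow, ← Complex.exp_nat_mul, ← Complex.exp_nat_mul,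
    mul_mul_mul_comm, ← pow_add, ← Complex.exp_add]
  congr 2
  push_cast
  ring

theorem setIntegral_ball_radial_mul_pow_mul_star_pow (R : ℝ) (ρ : ℝ → ℂ) (i j : ℕ) :
    ∫ z in Metric.ball (0 : ℂ) R, ρ ‖z‖ * (z ^ i * star z ^ j) =
      if i = j then 2 * Real.pi * ∫ r in Set.Ioo 0 R, ρ r * r ^ (2 * i + 1) else 0 := by
  have hpolar : ∀ x ∈ Set.Ioo 0 R ×ˢ Set.Ioo (-Real.pi) Real.pi,
      x.1 • (ρ ‖Complex.polarCoord.symm x‖ *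
        (Complex.polarCoord.symm x ^ i * star (Complex.polarCoord.symm x) ^ j)) =
      ρ x.1 * x.1 ^ (i + j + 1) * Complex.exp (Complex.I * ((i - j : ℤ) : ℂ) * x.2) := by
    intro x hx
    rw [Complex.norm_polarCoord_symm, abs_of_pos hx.1.1, polarCoord_symm_eq_mul_exp,
      mul_exp_pow_mul_star_pow, Complex.real_smul]
    ring
  rw [setIntegral_ball_eq_polar,
    setIntegral_congr_fun (measurableSet_Ioo.prod measurableSet_Ioo) hpolar,
    Measure.volume_eq_prod, setIntegral_prod_mul (fun r : ℝ => ρ r * (r : ℂ) ^ (i + j + 1))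
      (fun θ : ℝ => Complex.exp (Complex.I * ((i - j : ℤ) : ℂ) * θ)),
    integral_exp_I_mul_int_mul]
  split_ifs with h0 h h
  · rw [h, two_mul j, mul_comm]
  · omega
  · omega
  · rw [mul_zero]

theorem setIntegral_Ioo_one_sub_sq_mul_pow (i : ℕ) :
    ∫ r in Set.Ioo (0 : ℝ) 1, (1 - (r : ℂ) ^ 2) * (r : ℂ) ^ (2 * i + 1) =
      1 / (2 * ((i + 1) * (i + 2)) : ℂ) := by
  have hreal : ∫ r in (0 : ℝ)..1, (r ^ (2 * i + 1) - r ^ (2 * i + 3)) =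
      1 / (2 * ((i + 1) * (i + 2)) : ℝ) := by
    rw [intervalIntegral.integral_sub (by simp) (by simp), integral_pow, integral_pow]
    push_cast
    field_simp
    ring
  calc ∫ r in Set.Ioo (0 : ℝ) 1, (1 - (r : ℂ) ^ 2) * (r : ℂ) ^ (2 * i + 1)
      = ∫ r in Set.Ioo (0 : ℝ) 1, ((r ^ (2 * i + 1) - r ^ (2 * i + 3) : ℝ) : ℂ) := by
        congr 1 with r
        push_cast
        ring
    _ = ((∫ r in (0 : ℝ)..1, (r ^ (2 * i + 1) - r ^ (2 * i + 3)) : ℝ) : ℂ) := by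
        rw [integral_complex_ofReal, ← integral_Ioc_eq_integral_Ioo,
          ← intervalIntegral.integral_of_le zero_le_one]
    _ = 1 / (2 * ((i + 1) * (i + 2)) : ℂ) := by
        rw [hreal]
        push_cast
        rfl

theorem setIntegral_ball_one_sub_mul_pow_mul_star_pow (i j : ℕ) :
    ∫ z in Metric.ball (0 : ℂ) 1, (1 - z * star z) * (z ^ i * star z ^ j) =
      if i = j then (Real.pi / ((i + 1) * (i + 2)) : ℂ) else 0 := by
  simp_rw [mul_star_eq_norm_sq]
  rw [setIntegral_ball_radial_mul_pow_mul_star_pow 1 (fun r => 1 - (r : ℂ) ^ 2),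
    setIntegral_Ioo_one_sub_sq_mul_pow]
  congr 1
  field_simp

end Polar

section Moments

theorem sub_one_inv_isBigO_pow_mul_one_sub_sq_inv (k : ℕ) :
    (fun r : ℝ => (r - 1)⁻¹) =O[𝓝 1] fun r => r ^ k * (1 - r ^ 2)⁻¹ := by
  have hquot : Tendsto (fun r : ℝ => -(1 + r) / r ^ k) (𝓝 1) (𝓝 (-(1 + 1) / 1 ^ k)) :=
    (tendsto_const_nhds.add tendsto_id).neg.div (tendsto_id.pow k) (by simp)
  refine ((hquot.isBigO_one ℝ).mul (Asymptotics.isBigO_refl (fun r => r ^ k * (1 - r ^ 2)⁻¹)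
    _)).congr' ?_ (by simp)
  filter_upwards [lt_mem_nhds one_pos] with r hr
  have hfactor : 1 - r ^ 2 = (r - 1) * -(1 + r) := by ring
  have hne : -(1 + r) ≠ 0 := by linarith
  rw [hfactor, mul_inv]
  field_simp [hne]

theorem lintegral_pow_mul_one_sub_sq_inv_eq_top (k : ℕ) :
    ∫⁻ r in Set.Ioo (0 : ℝ) 1, ENNReal.ofReal (r ^ k * (1 - r ^ 2)⁻¹) = ⊤ := by
  by_contra hfin
  rw [← Ne, lintegral_ofReal_ne_top_iff_integrable (by fun_prop)] at hfin
  · refine not_intervalIntegrable_of_sub_inv_isBigO_punctured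
      ((sub_one_inv_isBigO_pow_mul_one_sub_sq_inv k).mono nhdsWithin_le_nhds) zero_ne_one
      Set.right_mem_uIcc ?_
    rwa [intervalIntegrable_iff_integrableOn_Ioo_of_le zero_le_one]
  · filter_upwards [ae_restrict_mem measurableSet_Ioo] with r hr
    exact mul_nonneg (pow_nonneg hr.1.le k)
      (inv_nonneg.2 (sub_nonneg.2 (pow_le_one₀ hr.1.le hr.2.le)))

theorem lintegral_cos_pow_mul_sin_pow_ne_zero (m n : ℕ) :
    ∫⁻ θ in Set.Ioo (-Real.pi) Real.pi,
      ENNReal.ofReal (Real.cos θ ^ (2 * m) * Real.sin θ ^ (2 * n)) ≠ 0 := by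
  rw [← pos_iff_ne_zero, setLIntegral_pos_iff (by fun_prop)]
  have hpi := Real.pi_pos
  have hvol : 0 < volume (Set.Ioo 0 (Real.pi / 2)) := by simp [hpi]
  refine hvol.trans_le (measure_mono fun θ hθ => ⟨?_, by linarith [hθ.1], by linarith [hθ.2]⟩)
  have hcos := Real.cos_pos_of_mem_Ioo ⟨by linarith [hθ.1], hθ.2⟩
  have hsin := Real.sin_pos_of_pos_of_lt_pi hθ.1 (by linarith [hθ.2])
  exact (ENNReal.ofReal_pos.2 (by positivity)).ne'

theorem lintegral_diskMeasure_re_pow_mul_im_pow (m n : ℕ) :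
    ∫⁻ z, ENNReal.ofReal (z.re ^ (2 * m) * z.im ^ (2 * n)) ∂diskMeasure =
      (∫⁻ r in Set.Ioo (0 : ℝ) 1, ENNReal.ofReal (r ^ (2 * m + 2 * n + 1) * (1 - r ^ 2)⁻¹)) *
        ∫⁻ θ in Set.Ioo (-Real.pi) Real.pi,
          ENNReal.ofReal (Real.cos θ ^ (2 * m) * Real.sin θ ^ (2 * n)) := by
  rw [lintegral_diskMeasure (by fun_prop), setLIntegral_ball_eq_polar, ← lintegral_prod_mul
    (by fun_prop) (by fun_prop), Measure.prod_restrict, ← Measure.volume_eq_prod]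
  refine setLIntegral_congr_fun (measurableSet_Ioo.prod measurableSet_Ioo) fun x hx => ?_
  have hr : 0 < x.1 := hx.1.1
  have hr' : 0 ≤ (1 - x.1 ^ 2)⁻¹ :=
    inv_nonneg.2 (sub_nonneg.2 (pow_le_one₀ hr.le hx.1.2.le))
  have hre : (Complex.polarCoord.symm x).re = x.1 * Real.cos x.2 := by
    simp [Complex.polarCoord_symm_apply, Complex.cos_ofReal_re]
  have him : (Complex.polarCoord.symm x).im = x.1 * Real.sin x.2 := by
    simp [Complex.polarCoord_symm_apply, Complex.sin_ofReal_re]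
  rw [Complex.norm_polarCoord_symm, sq_abs, hre, him, ← ENNReal.ofReal_mul hr',
    ← ENNReal.ofReal_mul hr.le, ← ENNReal.ofReal_mul (by positivity)]
  congr 1
  ring

theorem lintegral_diskMeasure_re_pow_mul_im_pow_eq_top (m n : ℕ) :
    ∫⁻ z, ENNReal.ofReal (z.re ^ (2 * m) * z.im ^ (2 * n)) ∂diskMeasure = ⊤ := by
  rw [lintegral_diskMeasure_re_pow_mul_im_pow, lintegral_pow_mul_one_sub_sq_inv_eq_top,
    ENNReal.top_mul (lintegral_cos_pow_mul_sin_pow_ne_zero m n)]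

end Moments

section Orthogonality

theorem sum_neg_one_pow_mul_choose_mul_eval_eq_zero {R : Type*} [CommRing R] {P : Polynomial R}
    {n : ℕ} (hP : P.natDegree < n) :
    ∑ k ∈ Finset.range (n + 1), (-1) ^ k * (n.choose k : R) * P.eval (k : R) = 0 := by
  have hdiff := congrFun (Polynomial.fwdDiff_iter_eq_zero_of_degree_lt hP) 0
  rw [fwdDiff_iter_eq_sum_shift] at hdiff
  rw [Pi.zero_apply] at hdiff
  rw [← mul_zero ((-1 : R) ^ n), ← hdiff, Finset.mul_sum]
  refine Finset.sum_congr rfl fun k hk => ?_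
  obtain ⟨m, rfl⟩ := Nat.exists_eq_add_of_le (Finset.mem_range_succ_iff.1 hk)
  have hsign : (-1 : R) ^ m * (-1) ^ m = 1 := by rw [← mul_pow, neg_one_mul, neg_neg, one_pow]
  rw [Nat.add_sub_cancel_left, zsmul_eq_mul, nsmul_one, zero_add, pow_add]
  push_cast
  linear_combination (-(-1) ^ k * ((k + m).choose k : R) * P.eval (k : R)) * hsign

theorem descFactorial_add_add_two (n u i : ℕ) :
    (n + 2 + u).descFactorial (i + 2 + u) =
      (n + 2 + u).descFactorial u * ((n + 2) * (n + 1)) * n.descFactorial i := by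
  rw [← Nat.descFactorial_mul_descFactorial (Nat.le_add_left u (i + 2)), Nat.add_sub_cancel,
    Nat.add_sub_cancel, Nat.succ_descFactorial_succ, Nat.succ_descFactorial_succ]
  ring

theorem choose_div_eq_descFactorial_mul_div (n u i : ℕ) :
    ((n + 2 + u).choose (i + 2 + u) : ℂ) / ((n + 1) * (n + 2)) =
      (n + 2 + u).descFactorial u * n.descFactorial i / (i + 2 + u).factorial := by
  have hdesc := descFactorial_add_add_two n u i
  rw [Nat.descFactorial_eq_factorial_mul_choose] at hdesc
  have h1 : (n + 1 : ℂ) ≠ 0 := n.cast_add_one_ne_zero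
  have h2 : (n + 2 : ℂ) ≠ 0 := mod_cast (n + 1).succ_ne_zero
  have hfact : ((i + 2 + u).factorial : ℂ) ≠ 0 := mod_cast (i + 2 + u).factorial_ne_zero
  rw [div_eq_div_iff (mul_ne_zero h1 h2) hfact]
  norm_cast
  linear_combination hdesc

theorem sum_scatteringCoeff_div_eq_zero {p q i j : ℕ} (h : p + i = q + j) (hi : i + 1 < q) :
    ∑ m ∈ Finset.range q,
      (scatteringCoeff p q m : ℂ) / (((m + j : ℕ) + 1) * ((m + j : ℕ) + 2)) = 0 := by
  obtain ⟨u, rfl⟩ : ∃ u, q = i + 2 + u := ⟨q - i - 2, by omega⟩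
  obtain rfl : p = j + 2 + u := by omega
  -- By `choose_div_eq_descFactorial_mul_div` the summand is `(-1) ^ m * (q - 1).choose m` times a
  -- multiple of `P.eval m`, so the sum is a finite difference of order above the degree of `P`.
  let P : Polynomial ℂ :=
    (descPochhammer ℂ u).comp (.X + .C ((j + 2 + u : ℕ) : ℂ)) *
      (descPochhammer ℂ i).comp (.X + .C (j : ℂ))
  have hdeg : P.natDegree < i + 1 + u := by
    refine Polynomial.natDegree_mul_le.trans_lt ?_
    simp only [Polynomial.natDegree_comp, Polynomial.natDegree_X_add_C, descPochhammer_natDegree]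
    omega
  have heval (m : ℕ) : P.eval (m : ℂ) =
      (m + j + 2 + u).descFactorial u * (m + j).descFactorial i := by
    simp only [P, Polynomial.eval_mul, Polynomial.eval_comp, Polynomial.eval_add,
      Polynomial.eval_X, Polynomial.eval_C, ← Nat.cast_add, ← Nat.add_assoc,
      descPochhammer_eval_eq_descFactorial]
  have hsum := sum_neg_one_pow_mul_choose_mul_eval_eq_zero hdeg
  rw [(by ring : i + 1 + u + 1 = i + 2 + u)] at hsum
  rw [← zero_div ((i + 2 + u).factorial : ℂ), ← hsum, Finset.sum_div]
  refine Finset.sum_congr rfl fun m _ => ?_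
  rw [mul_div_assoc, heval, ← choose_div_eq_descFactorial_mul_div, scatteringCoeff,
    (by omega : i + 2 + u - 1 = i + 1 + u), (by ring : j + 2 + u + m = m + j + 2 + u)]
  push_cast
  ring

theorem setIntegral_ball_pow_mul_scatteringCofactor_eq_zero {p q i j : ℕ}
    (h : p + i ≠ q + j ∨ i + 1 < q) :
    ∫ z in Metric.ball (0 : ℂ) 1,
      (1 - z * star z) * (star z ^ i * z ^ j) * scatteringCofactor p q z = 0 := by
  have hexpand (z : ℂ) : (1 - z * star z) * (star z ^ i * z ^ j) * scatteringCofactor p q z =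
      ∑ m ∈ Finset.range q, (scatteringCoeff p q m : ℂ) *
        ((1 - z * star z) * (z ^ (m + j) * star z ^ (p + m - q + i))) := by
    rw [scatteringCofactor, Finset.mul_sum]
    refine Finset.sum_congr rfl fun m _ => ?_
    ring
  have hterm (m : ℕ) : ∫ z in Metric.ball (0 : ℂ) 1, (scatteringCoeff p q m : ℂ) *
      ((1 - z * star z) * (z ^ (m + j) * star z ^ (p + m - q + i))) =
      if p + i = q + j then
        Real.pi * ((scatteringCoeff p q m : ℂ) / (((m + j : ℕ) + 1) * ((m + j : ℕ) + 2)))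
      else 0 := by
    rcases lt_or_ge (p + m) q with hm | hm
    · simp [scatteringCoeff_eq_zero_of_lt hm]
    · rw [integral_const_mul, setIntegral_ball_one_sub_mul_pow_mul_star_pow, mul_ite, mul_zero,
        mul_div_left_comm]
      exact if_congr (by omega) rfl rfl
  simp_rw [hexpand]
  rw [integral_finsetSum _ fun m _ => integrableOn_ball_of_continuous (by fun_prop) 1]
  simp_rw [hterm]
  by_cases hij : p + i = q + j
  · simp only [if_pos hij]
    rw [← Finset.mul_sum,
      sum_scatteringCoeff_div_eq_zero hij (h.resolve_left (not_not.2 hij)), mul_zero]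
  · simp only [if_neg hij, Finset.sum_const_zero]

theorem continuous_scatteringPoly (p : ℕ) {q : ℕ} (hq : 1 ≤ q) :
    Continuous (scatteringPoly p q) := by
  rw [funext (scatteringPoly_eq_mul_cofactor p hq)]
  have := continuous_scatteringCofactor p q
  fun_prop

theorem memLp_scatteringPoly (p : ℕ) {q : ℕ} (hq : 1 ≤ q) :
    MemLp (scatteringPoly p q) 2 diskMeasure := by
  rw [funext (scatteringPoly_eq_mul_cofactor p hq)]
  exact memLp_one_sub_mul_star_mul (continuous_scatteringCofactor p q)

theorem star_scatteringPoly (p : ℕ) {q : ℕ} (hq : 1 ≤ q) (z : ℂ) :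
    star (scatteringPoly p q z) =
      ∑ m ∈ Finset.range q, (scatteringCoeff p q m : ℂ) *
        ((1 - z * star z) * (star z ^ m * z ^ (p + m - q))) := by
  rw [scatteringPoly_eq_mul_cofactor p hq, scatteringCofactor]
  simp only [star_mul', star_sub, star_one, star_star, star_sum, star_pow, star_intCast,
    Finset.mul_sum]
  refine Finset.sum_congr rfl fun m _ => ?_
  ring

theorem inner_toLp_scatteringPoly_eq_zero {p q p' q' : ℕ} (hq : 1 ≤ q) (hq' : 1 ≤ q')
    (h : p + q' ≠ p' + q ∨ q < q') (hφ : MemLp (scatteringPoly p q) 2 diskMeasure)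
    (hφ' : MemLp (scatteringPoly p' q') 2 diskMeasure) :
    inner ℂ (hφ.toLp (scatteringPoly p q)) (hφ'.toLp (scatteringPoly p' q')) = 0 := by
  have hcont := continuous_scatteringCofactor p' q'
  rw [inner_toLp_eq_setIntegral hφ hφ' (scatteringPoly_eq_mul_cofactor p' hq')]
  simp_rw [star_scatteringPoly p hq, Finset.sum_mul, mul_assoc (scatteringCoeff p q _ : ℂ)]
  rw [integral_finsetSum _ fun m _ => integrableOn_ball_of_continuous (by fun_prop) 1]
  refine Finset.sum_eq_zero fun m hm => ?_
  have hmq := Finset.mem_range.1 hm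
  rcases lt_or_ge (p + m) q with hlt | hge
  · simp [scatteringCoeff_eq_zero_of_lt hlt]
  · rw [integral_const_mul, setIntegral_ball_pow_mul_scatteringCofactor_eq_zero (by omega),
      mul_zero]

end Orthogonality

section Completeness

/-- The continuous functional `f ↦ ∫ f g dμ` defined by an integrable function `g` on a compact
space, through which a density statement about continuous functions is applied to `g`. -/
noncomputable def integralMulCLM {α : Type*} [TopologicalSpace α] [CompactSpace α]
    [MeasurableSpace α] [BorelSpace α] {μ : Measure α} {g : α → ℂ} (hg : Integrable g μ) :
    C(α, ℂ) →L[ℂ] ℂ :=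
  have hint (f : C(α, ℂ)) : Integrable (fun x => f x * g x) μ :=
    hg.bdd_mul f.continuous.aestronglyMeasurable (.of_forall f.norm_coe_le_norm)
  LinearMap.mkContinuous
    { toFun := fun f => ∫ x, f x * g x ∂μ
      map_add' := fun f f' => by
        simp only [ContinuousMap.add_apply, add_mul]
        exact integral_add (hint f) (hint f')
      map_smul' := fun c f => by
        simp only [ContinuousMap.smul_apply, smul_mul_assoc, RingHom.id_apply]
        exact integral_smul c _ }
    (∫ x, ‖g x‖ ∂μ)
    fun f => by
      rw [mul_comm, ← integral_const_mul]
      refine norm_integral_le_of_norm_le (hg.norm.const_mul _) (.of_forall fun x => ?_)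
      rw [norm_mul]
      exact mul_le_mul_of_nonneg_right (f.norm_coe_le_norm x) (norm_nonneg _)

theorem scatteringCoeff_succ_self_ne_zero (i j : ℕ) : scatteringCoeff (j + 1) (i + 1) i ≠ 0 := by
  simp [scatteringCoeff, Nat.choose_eq_zero_iff]

theorem pow_mul_star_pow_mem_span_scatteringCofactor {A : Type*} [Ring A] [Star A]
    [Algebra ℂ A] (x : A) (i j : ℕ) :
    x ^ i * star x ^ j ∈
      Submodule.span ℂ (Set.range fun pq : ℕ+ × ℕ+ => scatteringCofactor pq.1 pq.2 x) := by
  induction i using Nat.strong_induction_on generalizing j with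
  | _ i ih =>
    have hcofactor : scatteringCofactor (j + 1) (i + 1) x =
        ∑ m ∈ Finset.range i,
          (scatteringCoeff (j + 1) (i + 1) m : ℂ) • (x ^ m * star x ^ (j + 1 + m - (i + 1))) +
        (scatteringCoeff (j + 1) (i + 1) i : ℂ) • (x ^ i * star x ^ j) := by
      rw [scatteringCofactor, Finset.sum_range_succ, (by omega : j + 1 + i - (i + 1) = j)]
      simp only [Int.cast_smul_eq_zsmul, zsmul_eq_mul]
    have hne : (scatteringCoeff (j + 1) (i + 1) i : ℂ) ≠ 0 :=
      mod_cast scatteringCoeff_succ_self_ne_zero i j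
    rw [← Submodule.smul_mem_iff _ hne, ← Submodule.add_mem_iff_right _ (Submodule.sum_mem _
      fun m hm => Submodule.smul_mem _ _ (ih m (Finset.mem_range.1 hm) _)), ← hcofactor]
    exact Submodule.subset_span ⟨(j.succPNat, i.succPNat), rfl⟩

theorem dense_span_scatteringCofactor (K : Set ℂ) [CompactSpace K] :
    Dense (Submodule.span ℂ (Set.range fun pq : ℕ+ × ℕ+ =>
      scatteringCofactor pq.1 pq.2 ((ContinuousMap.id ℂ).restrict K)) : Set C(K, ℂ)) := by
  have hadjoin : ((polynomialFunctions K).starClosure : Set C(K, ℂ)) ⊆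
      Submodule.span ℂ (Set.range fun pq : ℕ+ × ℕ+ =>
        scatteringCofactor pq.1 pq.2 ((ContinuousMap.id ℂ).restrict K)) := by
    intro f hf
    have hX : Polynomial.toContinuousMapOnAlgHom K Polynomial.X =
        (ContinuousMap.id ℂ).restrict K := by
      ext z
      simp
    rw [polynomialFunctions.starClosure_eq_adjoin_X, hX, SetLike.mem_coe,
      ← StarSubalgebra.mem_toSubalgebra, StarAlgebra.adjoin_toSubalgebra,
      ← Subalgebra.mem_toSubmodule, Algebra.adjoin_eq_span, Set.star_singleton,
      Set.singleton_union] at hf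
    refine Submodule.span_le.2 (fun g hg => ?_) hf
    obtain ⟨i, j, rfl⟩ := (Submonoid.mem_closure_pair _ _ _).1 hg
    exact pow_mul_star_pow_mem_span_scatteringCofactor _ i j
  refine Dense.mono hadjoin ?_
  rw [dense_iff_closure_eq, ← StarSubalgebra.topologicalClosure_coe,
    polynomialFunctions.starClosure_topologicalClosure, StarSubalgebra.coe_top]

theorem scatteringCofactor_restrict_apply (p q : ℕ) {K : Set ℂ} (z : K) :
    scatteringCofactor p q ((ContinuousMap.id ℂ).restrict K) z =
      scatteringCofactor p q (z : ℂ) := by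
  simp [scatteringCofactor]

theorem ae_eq_zero_of_setIntegral_scatteringCofactor_mul_eq_zero {μ : Measure ℂ} {K : Set ℂ}
    (hK : IsCompact K) {G : ℂ → ℂ} (hG : IntegrableOn G K μ)
    (horth : ∀ pq : ℕ+ × ℕ+, ∫ z in K, scatteringCofactor pq.1 pq.2 z * G z ∂μ = 0) :
    ∀ᵐ z ∂μ.restrict K, G z = 0 := by
  have : CompactSpace K := isCompact_iff_compactSpace.1 hK
  have hGK : Integrable (fun z : K => G z) (μ.comap Subtype.val) :=
    (integrableOn_iff_comap_subtypeVal hK.measurableSet).1 hG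
  have hfunctional : integralMulCLM hGK = 0 := by
    refine ContinuousLinearMap.ext_on (dense_span_scatteringCofactor K) ?_
    rintro _ ⟨pq, rfl⟩
    rw [zero_apply, ← horth pq, ← integral_subtype_comap hK.measurableSet]
    exact integral_congr_ae (.of_forall fun z => by
      simp only [scatteringCofactor_restrict_apply])
  refine ae_eq_zero_of_integral_contDiff_smul_eq_zero hG.locallyIntegrable fun g hg _ => ?_
  have hgK : Continuous fun z : K => (g z : ℂ) := by
    have := hg.continuous
    fun_prop
  rw [← integral_subtype_comap hK.measurableSet]
  exact DFunLike.congr_fun hfunctional ⟨_, hgK⟩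

theorem topologicalClosure_span_toLp_scatteringPoly
    (hL2 : ∀ i : ℕ+ × ℕ+, MemLp (scatteringPoly i.1 i.2) 2 diskMeasure) :
    (Submodule.span ℂ (Set.range fun i : ℕ+ × ℕ+ =>
      (hL2 i).toLp (scatteringPoly i.1 i.2))).topologicalClosure = ⊤ := by
  rw [Submodule.topologicalClosure_eq_top_iff, Submodule.eq_bot_iff]
  intro G hG
  have hvol : volume.restrict (Metric.ball (0 : ℂ) 1) =
      (volume.restrict (Metric.ball (0 : ℂ) 1)).restrict (Metric.closedBall 0 1) :=
    (Measure.restrict_eq_self_of_ae_mem <| (ae_restrict_mem measurableSet_ball).mono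
      fun z hz => Metric.ball_subset_closedBall hz).symm
  have hmem := Lp.memLp G
  have hint : IntegrableOn (fun z => star (G z)) (Metric.closedBall (0 : ℂ) 1)
      (volume.restrict (Metric.ball (0 : ℂ) 1)) := by
    have : IsFiniteMeasure (volume.restrict (Metric.ball (0 : ℂ) 1)) := ⟨by simp⟩
    rw [IntegrableOn, ← hvol]
    exact (hmem.mono_measure volume_restrict_ball_le_diskMeasure).star.integrable one_le_two
  have horth (i : ℕ+ × ℕ+) : ∫ z in Metric.ball (0 : ℂ) 1,
      scatteringCofactor i.1 i.2 z * star (G z) = 0 := by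
    simp_rw [mul_comm _ (star (G _))]
    rw [← inner_toLp_eq_setIntegral hmem (hL2 i) (scatteringPoly_eq_mul_cofactor _ i.2.pos),
      Lp.toLp_coeFn]
    exact (Submodule.mem_orthogonal' _ _).1 hG _ (Submodule.subset_span ⟨i, rfl⟩)
  have hzero : ∀ᵐ z ∂(volume.restrict (Metric.ball (0 : ℂ) 1)), star (G z) = 0 := by
    rw [hvol] at horth ⊢
    exact ae_eq_zero_of_setIntegral_scatteringCofactor_mul_eq_zero (isCompact_closedBall 0 1)
      hint horth
  rw [Lp.eq_zero_iff_ae_eq_zero]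
  filter_upwards [diskMeasure_absolutelyContinuous.ae_le hzero] with z hz
  exact star_eq_zero.1 hz

end Completeness

section Basis

theorem toLp_scatteringPoly_ne_zero {p q : ℕ} (hp : 1 ≤ p) (hq : 1 ≤ q)
    (hφ : MemLp (scatteringPoly p q) 2 diskMeasure) : hφ.toLp (scatteringPoly p q) ≠ 0 := by
  intro hzero
  have hae : scatteringPoly p q =ᵐ[diskMeasure] 0 :=
    hφ.coeFn_toLp.symm.trans (Lp.eq_zero_iff_ae_eq_zero.1 hzero)
  have hball : Set.EqOn (scatteringPoly p q) 0 (Metric.ball (0 : ℂ) 1) :=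
    Measure.eqOn_open_of_ae_eq (ae_mono volume_restrict_ball_le_diskMeasure hae) Metric.isOpen_ball
      (continuous_scatteringPoly p hq).continuousOn continuousOn_const
  have hcofactor : Set.EqOn (scatteringCofactor p q) 0 (Metric.ball (0 : ℂ) 1) := by
    intro z hz
    have hz0 := hball hz
    rw [scatteringPoly_eq_mul_cofactor p hq, one_sub_mul_star] at hz0
    exact (mul_eq_zero.1 hz0).resolve_left (mod_cast (one_sub_norm_sq_pos hz).ne')
  have hclosure := hcofactor.closure (continuous_scatteringCofactor p q) continuous_const
  rw [closure_ball _ one_ne_zero] at hclosure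
  exact scatteringCofactor_one_ne_zero hp hq (hclosure (by simp))

theorem isOrthogonalBasis_scatteringPoly
    (hL2 : ∀ i : ℕ+ × ℕ+, MemLp (scatteringPoly i.1 i.2) 2 diskMeasure) :
    IsOrthogonalBasis (H := Lp ℂ 2 diskMeasure)
      fun i : ℕ+ × ℕ+ => (hL2 i).toLp (scatteringPoly i.1 i.2) where
  ne_zero i := toLp_scatteringPoly_ne_zero i.1.pos i.2.pos (hL2 i)
  orthogonal := by
    rintro ⟨p, q⟩ ⟨p', q'⟩ hne
    have hne' : ¬((p : ℕ) = p' ∧ (q : ℕ) = q') := fun h =>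
      hne (Prod.ext (PNat.coe_injective h.1) (PNat.coe_injective h.2))
    by_cases h : (p : ℕ) + q' ≠ p' + q ∨ (q : ℕ) < q'
    · exact inner_toLp_scatteringPoly_eq_zero q.pos q'.pos h _ _
    · rw [inner_eq_zero_symm]
      exact inner_toLp_scatteringPoly_eq_zero q'.pos q.pos (by omega) _ _
  dense_span := topologicalClosure_span_toLp_scatteringPoly hL2

end Basis

theorem theorem1 :
    -- the scattering polynomials are polynomials in `x` and `y`
    (∀ p q : ℕ, 1 ≤ p → 1 ≤ q → ∃ P : MvPolynomial (Fin 2) ℂ, ∀ z : ℂ,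
      scatteringPoly p q z = MvPolynomial.eval ![(z.re : ℂ), (z.im : ℂ)] P) ∧
    -- they form an orthogonal basis of the weighted `L²` space
    (∃ hL2 : ∀ i : ℕ+ × ℕ+, MeasureTheory.MemLp (scatteringPoly i.1 i.2) 2 diskMeasure,
      IsOrthogonalBasis (H := MeasureTheory.Lp ℂ 2 diskMeasure)
        fun i : ℕ+ × ℕ+ => (hL2 i).toLp (scatteringPoly i.1 i.2)) ∧
    -- all even moments of the measure are infinite
    (∀ m n : ℕ, ∫⁻ z, ENNReal.ofReal (z.re ^ (2 * m) * z.im ^ (2 * n)) ∂diskMeasure = ⊤) ∧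
    -- they are eigenfunctions of `-(1 - |z|²) Δ / 4`
    (∀ p q : ℕ, 1 ≤ p → 1 ≤ q → ∀ z : ℂ,
      -((1 - (‖z‖ : ℂ) ^ 2) / 4 * Laplacian.laplacian (scatteringPoly p q) z) =
        (p : ℂ) * (q : ℂ) * scatteringPoly p q z) ∧
    -- they are represented by Jacobi polynomials in polar coordinates
    (∀ p q : ℕ, 1 ≤ p → 1 ≤ q → ∀ r θ : ℝ,
      scatteringPoly p q ((r : ℂ) * Complex.exp (Complex.I * θ)) =
        (-1) ^ (q + 1) * (max p q : ℕ) / (q : ℂ) *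
          (((1 - r ^ 2) * r ^ ((p : ℤ) - (q : ℤ)).natAbs *
            jacobiP 1 ((p : ℤ) - (q : ℤ)).natAbs (min p q - 1) (2 * r ^ 2 - 1) : ℝ) : ℂ) *
          Complex.exp (Complex.I * ((q : ℂ) - (p : ℂ)) * θ)) := by
  exact ⟨fun p q _ hq => exists_mvPolynomial_eq_scatteringPoly p hq,
    ⟨fun i => memLp_scatteringPoly i.1 i.2.pos, isOrthogonalBasis_scatteringPoly _⟩,
    lintegral_diskMeasure_re_pow_mul_im_pow_eq_top,
    fun p q _ hq z => neg_mul_laplacian_scatteringPoly p hq z,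
    fun p q hp hq r θ => scatteringPoly_polar hp hq r θ⟩
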